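/- Let $K$ be an algebraically closed field and let $G$ be an algebraic group over $K$ (a reduced separated group scheme of finite type over $K$, not necessarily affine, identified with its group of $K$-points with the Zariski topology; "algebraic subgroup" means Zariski-closed subgroup). The ascending central series $(\zeta^{\alpha}(G))_{\alpha}$ of the abstract group $G$, indexed by the ordinals, is defined by $\zeta^0(G)=\{1\}$, $\zeta^{\alpha+1}(G)$ = the preimage in $G$ of the centre of $G/\zeta^{\alpha}(G)$, and $\zeta^{\alpha}(G)=\bigcup_{\beta<\alpha}\zeta^{\beta}(G)$ for $\alpha$ a limit ordinal; the hypercentre $\zeta^{\uparrow}(G)$ is the union of all the $\zeta^{\alpha}(G)$. Assume that $G$ is connected or, more generally, that $\zeta^{\uparrow}(G)$ is Zariski-closed in $G$; let $H=G/\zeta^{\uparrow}(G)$ be the quotient algebraic group and $\pi:G\to H$ the canonical projection. An algebraic group, or an algebraic subgroup, is called indecomposable if it is not reduced to one element and is not the (internal) direct product of two algebraic subgroups both different from $\{1\}$; direct products are understood for the underlying abstract groups. Let $\Gamma$ be a Zariski-dense subgroup of $G$, and let $A,B$ be two subgroups of $\Gamma$ such that $\Gamma=A\times B$ (internal direct product).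 (1) Let $H=H_1\times\cdots\times H_n$, with $n\ge 0$, be a decomposition of $H$ as the direct product of indecomposable algebraic subgroups (the canonical decomposition of $H$). Set $G_i=\pi^{-1}(H_i)$ for $i\in\{1,\dots,n\}$; an empty product of the $G_i$ is understood as $\zeta^{\uparrow}(G)$. Then $G=G_1\cdots G_n$ and $G_i\cap\prod_{j\ne i}G_j=\zeta^{\uparrow}(G)$ for every $i\in\{1,\dots,n\}$, and there exist a renumbering of the $G_i$ and an integer $m\in\{0,\dots,n\}$ such that $$A\subset G_1\cdots G_m\qquad\text{and}\qquad B\subset G_{m+1}\cdots G_n .$$ (2) In particular, if $H$ is indecomposable as an algebraic group, then one of $A$, $B$ is contained in the hypercentre $\zeta^{\uparrow}(G)$. -/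

import Mathlib

universe u

namespace DirectDecomposition

section AbstractGroups

/-- One step of the ascending central series, bundled with normality: from a normal subgroup `N`
to the preimage of the centre of `G ⧸ N` under the canonical projection. -/
def centralStep {G : Type u} [Group G] (N : {N : Subgroup G // N.Normal}) :
    {N : Subgroup G // N.Normal} :=
  haveI := N.2
  ⟨(Subgroup.center (G ⧸ N.1)).comap (QuotientGroup.mk' N.1), inferInstance⟩

/-- The transfinite ascending central series, bundled with normality. At a limit ordinal one takes
the union of the previous terms (see `coe_zeta_limit`), which is the supremum since they form a
chain. -/
noncomputable def zetaAux (G : Type u) [Group G] (α : Ordinal.{u}) :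
    {N : Subgroup G // N.Normal} :=
  Ordinal.limitRecOn (motive := fun _ => {N : Subgroup G // N.Normal}) α
    ⟨⊥, inferInstance⟩
    (fun _ N => centralStep N)
    (fun o _ ih => ⟨⨆ β : Set.Iio o, (ih β.1 β.2).1,
      have : ∀ β : Set.Iio o, (ih β.1 β.2).1.Normal := fun β => (ih β.1 β.2).2
      Subgroup.iSup_normal _⟩)

/-- The term of index `α` of the ascending central series of `G`. -/
noncomputable def zeta (G : Type u) [Group G] (α : Ordinal.{u}) : Subgroup G :=
  (zetaAux G α).1

instance zeta_normal (G : Type u) [Group G] (α : Ordinal.{u}) : (zeta G α).Normal :=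
  (zetaAux G α).2

theorem zeta_zero (G : Type u) [Group G] : zeta G 0 = ⊥ := by
  simp [zeta, zetaAux]

theorem zeta_add_one (G : Type u) [Group G] (α : Ordinal.{u}) :
    zeta G (α + 1) = (Subgroup.center (G ⧸ zeta G α)).comap (QuotientGroup.mk' (zeta G α)) := by
  simp only [zeta, zetaAux, Ordinal.limitRecOn_add_one]
  rfl

theorem zeta_limit (G : Type u) [Group G] (α : Ordinal.{u}) (hα : Order.IsSuccLimit α) :
    zeta G α = ⨆ β : Set.Iio α, zeta G β.1 := by
  simp only [zeta, zetaAux]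
  rw [Ordinal.limitRecOn_limit _ _ _ _ hα]

theorem zeta_le_add_one (G : Type u) [Group G] (α : Ordinal.{u}) :
    zeta G α ≤ zeta G (α + 1) := by
  intro x hx
  rw [zeta_add_one, Subgroup.mem_comap, QuotientGroup.mk'_apply,
    (QuotientGroup.eq_one_iff x).2 hx]
  exact Subgroup.one_mem _

theorem zeta_mono (G : Type u) [Group G] : Monotone (zeta G) := by
  intro α β
  induction β using Ordinal.limitRecOn with
  | zero => intro h; rw [nonpos_iff_eq_zero.1 h]
  | add_one β ih =>
    intro h
    rcases h.eq_or_lt with rfl | h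
    · exact le_rfl
    · exact (ih (Order.lt_add_one_iff.1 h)).trans (zeta_le_add_one G β)
  | limit β hβ _ =>
    intro h
    rcases h.eq_or_lt with rfl | h
    · exact le_rfl
    · rw [zeta_limit G β hβ]
      exact le_iSup (fun γ : Set.Iio β => zeta G γ.1) ⟨α, h⟩

theorem coe_zeta_limit (G : Type u) [Group G] (α : Ordinal.{u}) (hα : Order.IsSuccLimit α) :
    (zeta G α : Set G) = ⋃ β : Set.Iio α, (zeta G β.1 : Set G) := by
  have : Nonempty (Set.Iio α) := ⟨⟨0, hα.bot_lt⟩⟩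
  rw [zeta_limit G α hα]
  exact Subgroup.coe_iSup_of_directed
    (Monotone.directed_le fun _ _ h => zeta_mono G h)

/-- The hypercentre of `G`: the union (equivalently, since they form a chain, the supremum) of all
terms of the ascending central series (see `mem_hypercenter_iff`). -/
noncomputable def hypercenter (G : Type u) [Group G] : Subgroup G :=
  ⨆ α : Ordinal.{u}, zeta G α

theorem mem_hypercenter_iff {G : Type u} [Group G] {x : G} :
    x ∈ hypercenter G ↔ ∃ α : Ordinal.{u}, x ∈ zeta G α :=
  Subgroup.mem_iSup_of_directed (zeta_mono G).directed_le

instance hypercenter_normal (G : Type u) [Group G] : (hypercenter G).Normal :=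
  Subgroup.iSup_normal _

/-- The subgroup `M` is the (internal) direct product of its subgroups `A` and `B`. -/
structure IsDirectProduct {G : Type u} [Group G] (M A B : Subgroup G) : Prop where
  commute : ∀ a ∈ A, ∀ b ∈ B, Commute a b
  inf_eq : A ⊓ B = ⊥
  sup_eq : A ⊔ B = M

/-- The subgroup `M` is the (internal) direct product of the subgroups `H i`: they commute
elementwise with each other, each one meets trivially the subgroup generated by the others, and
together they generate `M`. -/
structure IsInternalDirectProduct {G : Type u} [Group G] {ι : Type*} (M : Subgroup G)
    (H : ι → Subgroup G) : Prop where
  commute : ∀ i j, i ≠ j → ∀ x ∈ H i, ∀ y ∈ H j, Commute x y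
  indep : iSupIndep H
  iSup_eq : ⨆ i, H i = M

/-- For a group with a (Zariski) topology, whose algebraic subgroups are its closed subgroups:
the subgroup `M` is algebraic, is not reduced to one element, and is not the direct product of two
algebraic subgroups in a nontrivial way. -/
structure IsIndecomposable {G : Type u} [Group G] [TopologicalSpace G] (M : Subgroup G) :
    Prop where
  isClosed : IsClosed (M : Set G)
  ne_bot : M ≠ ⊥
  eq_bot_or : ∀ P Q : Subgroup G, IsClosed (P : Set G) → IsClosed (Q : Set G) →
    IsDirectProduct M P Q → P = ⊥ ∨ Q = ⊥

/-- For subgroups `H i` of `G ⧸ N`, with preimages `π⁻¹(H i)` in `G`, the product of the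
`π⁻¹(H i)` with `i ∈ S`, where a product over the empty set is understood to be `N`, the preimage of
the trivial subgroup. (When `S` is nonempty, `N` is contained in the other factors; and when the
`π⁻¹(H i)` are normal, the subgroup they generate is their product.) -/
def preimageProd {G : Type u} [Group G] (N : Subgroup G) [N.Normal] {ι : Type*}
    (H : ι → Subgroup (G ⧸ N)) (S : Set ι) : Subgroup G :=
  N ⊔ ⨆ i ∈ S, (H i).comap (QuotientGroup.mk' N)

end AbstractGroups

section AlgebraicGroups

open CategoryTheory AlgebraicGeometry
open scoped MonObj

/-- The group `G(K)` of `K`-points of a group scheme `G` over a field `K`. -/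
def Points {K : Type u} [Field K] (G : Over (Spec (.of K))) : Type u :=
  Over.mk (𝟙 (Spec (.of K))) ⟶ G

noncomputable instance {K : Type u} [Field K] (G : Over (Spec (.of K))) [GrpObj G] :
    Group (Points G) :=
  inferInstanceAs (Group (Over.mk (𝟙 (Spec (.of K))) ⟶ G))

/-- The point of the underlying topological space of `G` defined by a `K`-point. -/
noncomputable def Points.toPoint {K : Type u} [Field K] {G : Over (Spec (.of K))}
    (x : Points G) : G.left :=
  CommaMorphism.left x (IsLocalRing.closedPoint K)

/-- The Zariski topology on `G(K)`, induced by that of the scheme `G`. -/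
noncomputable instance {K : Type u} [Field K] (G : Over (Spec (.of K))) :
    TopologicalSpace (Points G) :=
  TopologicalSpace.induced Points.toPoint inferInstance

end AlgebraicGroups

end DirectDecomposition

namespace DirectDecomposition

/-! ### The ascending central series and direct decompositions of abstract groups -/

section AbstractGroups

open scoped commutatorElement

/-! Modulo the hypercentre the centre is trivial, and a group with trivial centre splits rigidly:
each direct factor is the centralizer of its complement, so decompositions `P × Q` and `X × Y`
refine to `P = (P ⊓ X) × (P ⊓ Y)` (`IsDirectProduct.inf_right`). When the hypercentre is closed,
such factors of the quotient are closed too, being centralizers. Hence an indecomposable factor lies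
in `X` or in `Y`.

As `Γ` is only dense, `A` and `B` are first enlarged to the closed commuting subgroups `C(B)` and
`C(C(B))`. Their product is constructible by Chevalley's theorem and dense, hence equal to `G`. They
may intersect, but only in central elements, which die modulo the hypercentre; their images
therefore decompose the quotient (`decomposition_of_sup_eq_top`).

For connected `G` the hypercentre is closed (`isClosed_hypercenter`): a step of finite index in the
central series forces it to stabilize, while a step of infinite index enlarges an irreducible closed
subset, which cannot go on forever. -/

theorem mem_zeta_add_one {G : Type u} [Group G] {α : Ordinal.{u}} {x : G} :
    x ∈ zeta G (α + 1) ↔ ∀ g : G, ⁅x, g⁆ ∈ zeta G α := by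
  rw [zeta_add_one, Subgroup.mem_comap, Subgroup.mem_center_iff]
  refine ⟨fun h g => ?_, fun h g => ?_⟩
  · rw [← QuotientGroup.ker_mk' (zeta G α), MonoidHom.mem_ker, map_commutatorElement,
      commutatorElement_eq_one_iff_mul_comm]
    exact (h _).symm
  · obtain ⟨g, rfl⟩ := QuotientGroup.mk'_surjective _ g
    have := h g
    rw [← QuotientGroup.ker_mk' (zeta G α), MonoidHom.mem_ker, map_commutatorElement,
      commutatorElement_eq_one_iff_mul_comm] at this
    exact this.symm

theorem zeta_le_hypercenter (G : Type u) [Group G] (α : Ordinal.{u}) :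
    zeta G α ≤ hypercenter G :=
  le_iSup (zeta G) α

/-- The ordinals witnessing membership of the commutators form a family indexed by `G`, hence
bounded; one step above the bound captures `x`. -/
theorem mem_hypercenter_of_commutator_mem {G : Type u} [Group G] {x : G}
    (h : ∀ g : G, ⁅x, g⁆ ∈ hypercenter G) : x ∈ hypercenter G := by
  simp only [mem_hypercenter_iff] at h
  choose f hf using h
  have hb : BddAbove (Set.range f) := Ordinal.bddAbove_of_small
  exact zeta_le_hypercenter G (sSup (Set.range f) + 1) <| mem_zeta_add_one.2 fun g =>
    zeta_mono G (le_csSup hb ⟨g, rfl⟩) (hf g)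

theorem center_quotient_hypercenter (G : Type u) [Group G] :
    Subgroup.center (G ⧸ hypercenter G) = ⊥ := by
  refine (Subgroup.eq_bot_iff_forall _).2 fun x hx => ?_
  obtain ⟨x, rfl⟩ := QuotientGroup.mk'_surjective _ x
  rw [QuotientGroup.mk'_apply, QuotientGroup.eq_one_iff]
  refine mem_hypercenter_of_commutator_mem fun g => ?_
  rw [← QuotientGroup.eq_one_iff, ← QuotientGroup.mk'_apply, map_commutatorElement]
  exact commutatorElement_eq_one_iff_mul_comm.2 (Subgroup.mem_center_iff.1 hx _).symm

/-- The successor step is monotone in the preceding term, so containment in a stable term passes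
from `β` to `β + 1`, and limits are suprema. -/
theorem hypercenter_eq_zeta_of_stable {G : Type u} [Group G] {α : Ordinal.{u}}
    (h : zeta G (α + 1) ≤ zeta G α) : hypercenter G = zeta G α := by
  refine le_antisymm (iSup_le fun β => ?_) (zeta_le_hypercenter G α)
  induction β using Ordinal.limitRecOn with
  | zero => simp [zeta_zero]
  | add_one β ih =>
    exact fun x hx => h (mem_zeta_add_one.2 fun g => ih (mem_zeta_add_one.1 hx g))
  | limit β hβ ih =>
    rw [zeta_limit G β hβ]
    exact iSup_le fun γ => ih γ.1 γ.2

/-! ### Direct factors in groups with trivial centre -/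

namespace IsDirectProduct

variable {G : Type u} [Group G] {M X Y : Subgroup G}

theorem symm (h : IsDirectProduct M X Y) : IsDirectProduct M Y X where
  commute a ha b hb := (h.commute b hb a ha).symm
  inf_eq := by rw [inf_comm, h.inf_eq]
  sup_eq := by rw [sup_comm, h.sup_eq]

theorem eq_one_of_mem (h : IsDirectProduct M X Y) {x : G} (hX : x ∈ X) (hY : x ∈ Y) : x = 1 := by
  have : x ∈ X ⊓ Y := ⟨hX, hY⟩
  rwa [h.inf_eq] at this

theorem exists_mul_of_mem (h : IsDirectProduct M X Y) {m : G} (hm : m ∈ M) :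
    ∃ x ∈ X, ∃ y ∈ Y, x * y = m := by
  have hle : X ≤ Subgroup.normalizer (Y : Set G) :=
    le_trans (fun x hx => Subgroup.mem_centralizer_iff.2 fun y hy => (h.commute x hx y hy).symm)
      (Subgroup.centralizer_le_normalizer _)
  rw [← h.sup_eq, ← SetLike.mem_coe, Subgroup.coe_mul_of_left_le_normalizer_right X Y hle] at hm
  exact hm

/-- In a group with trivial centre, a direct factor is the centralizer of its complement. -/
theorem mem_iff_of_center_eq_bot (hZ : Subgroup.center G = ⊥) (h : IsDirectProduct ⊤ X Y) {g : G} :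
    g ∈ X ↔ ∀ y ∈ Y, Commute g y := by
  refine ⟨fun hg => h.commute g hg, fun hg => ?_⟩
  obtain ⟨x, hx, y, hy, rfl⟩ := h.exists_mul_of_mem (Subgroup.mem_top g)
  -- Both `x * y` and `x` commute with `Y`, so `y` does; it also commutes with `X`.
  have hy' : y ∈ Subgroup.center G := Subgroup.mem_center_iff.2 fun k => by
    obtain ⟨x', hx', y', hy', rfl⟩ := h.exists_mul_of_mem (Subgroup.mem_top k)
    have h1 : Commute y' y := by
      have := (hg y' hy').symm.mul_right (h.commute x hx y' hy').symm.inv_right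
      simpa using (h.commute x hx y' hy').inv_left.mul_left (hg y' hy') |>.symm
    exact (h.commute x' hx' y hy).mul_left h1
  rw [hZ, Subgroup.mem_bot] at hy'
  simpa [hy'] using hx

/-- Two decompositions of a group with trivial centre as a direct product have a common
refinement. -/
theorem inf_right (hZ : Subgroup.center G = ⊥) {P Q : Subgroup G} (hP : IsDirectProduct ⊤ P Q)
    (h : IsDirectProduct ⊤ X Y) : IsDirectProduct P (P ⊓ X) (P ⊓ Y) where
  commute a ha b hb := h.commute a ha.2 b hb.2
  inf_eq := (Subgroup.eq_bot_iff_forall _).2 fun x hx => h.eq_one_of_mem hx.1.2 hx.2.2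
  sup_eq := by
    refine le_antisymm (sup_le inf_le_left inf_le_left) fun p hp => ?_
    obtain ⟨x, hx, y, hy, rfl⟩ := h.exists_mul_of_mem (Subgroup.mem_top p)
    suffices hxP : x ∈ P from
      mul_mem (Subgroup.mem_sup_left ⟨hxP, hx⟩)
        (Subgroup.mem_sup_right ⟨(P.mul_mem_cancel_left hxP).1 hp, hy⟩)
    refine (hP.mem_iff_of_center_eq_bot hZ).2 fun q hq => ?_
    obtain ⟨x', hx', y', hy', rfl⟩ := h.exists_mul_of_mem (Subgroup.mem_top q)
    have hcomm := (hP.commute _ hp _ hq).eq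
    have e1 : (x * y) * (x' * y') = (x * x') * (y * y') :=
      (h.commute x' hx' y hy).symm.mul_mul_mul_comm x y'
    have e2 : (x' * y') * (x * y) = (x' * x) * (y' * y) :=
      (h.commute x hx y' hy').symm.mul_mul_mul_comm x' y
    rw [e1, e2] at hcomm
    -- The commutation relation separates into an element of `X` equal to an element of `Y`; both
    -- are therefore trivial.
    have e3 : (x' * x)⁻¹ * (x * x') = (y' * y) * (y * y')⁻¹ := by
      rw [inv_mul_eq_iff_eq_mul, ← mul_assoc, eq_mul_inv_iff_mul_eq, hcomm]
    have e4 := h.eq_one_of_mem (mul_mem (inv_mem (mul_mem hx' hx)) (mul_mem hx hx'))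
      (e3 ▸ mul_mem (mul_mem hy' hy) (inv_mem (mul_mem hy hy')))
    have hxx : Commute x x' := (inv_mul_eq_one.1 e4).symm
    exact hxx.mul_right (h.commute x hx y' hy')

theorem le_or_le_of_isIndecomposable [TopologicalSpace G] (hZ : Subgroup.center G = ⊥)
    (hX : IsClosed (X : Set G)) (hY : IsClosed (Y : Set G)) {P Q : Subgroup G}
    (hP : IsDirectProduct ⊤ P Q) (h : IsDirectProduct ⊤ X Y) (hind : IsIndecomposable P) :
    P ≤ X ∨ P ≤ Y := by
  have hPXY := hP.inf_right hZ h
  rcases hind.eq_bot_or _ _ (hind.isClosed.inter hX) (hind.isClosed.inter hY) hPXY with h0 | h0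
  · have := hPXY.sup_eq
    rw [h0, bot_sup_eq] at this
    exact Or.inr (inf_eq_left.1 this)
  · have := hPXY.sup_eq
    rw [h0, sup_bot_eq] at this
    exact Or.inl (inf_eq_left.1 this)

end IsDirectProduct

theorem IsInternalDirectProduct.isDirectProduct_iSup_ne {G : Type u} [Group G] {ι : Type*}
    {M : Subgroup G} {H : ι → Subgroup G} (h : IsInternalDirectProduct M H) (i : ι) :
    IsDirectProduct M (H i) (⨆ j ≠ i, H j) where
  commute a ha b hb := by
    have : ⨆ j ≠ i, H j ≤ Subgroup.centralizer {a} := iSup₂_le fun j hj y hy =>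
      Subgroup.mem_centralizer_singleton_iff.2 (h.commute j i hj y hy a ha)
    exact (Subgroup.mem_centralizer_singleton_iff.1 (this hb)).symm
  inf_eq := disjoint_iff.1 (h.indep i)
  sup_eq := by
    rw [← h.iSup_eq]
    refine le_antisymm (sup_le (le_iSup _ _) (iSup₂_le fun j _ => le_iSup _ _))
      (iSup_le fun j => ?_)
    by_cases hj : j = i
    · exact hj ▸ le_sup_left
    · exact le_sup_of_le_right (le_iSup₂_of_le j hj le_rfl)

/-- If each `H i` is contained in one of the factors of a direct product `X × Y`, then each factor
is generated by the `H i` which it contains. -/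
theorem IsDirectProduct.le_iSup_of_forall_le_or_le {G : Type u} [Group G] {ι : Type*}
    {X Y : Subgroup G} {H : ι → Subgroup G} (h : IsDirectProduct ⊤ X Y) (hH : ⨆ i, H i = ⊤)
    {S : Set ι} (hS : ∀ i ∈ S, H i ≤ X) (hS' : ∀ i ∉ S, H i ≤ Y) : X ≤ ⨆ i ∈ S, H i := by
  intro x hx
  have hU : ⨆ i ∈ S, H i ≤ X := iSup₂_le hS
  have hV : ⨆ i ∉ S, H i ≤ Y := iSup₂_le hS'
  have hUV : IsDirectProduct ((⨆ i ∈ S, H i) ⊔ ⨆ i ∉ S, H i) (⨆ i ∈ S, H i) (⨆ i ∉ S, H i) :=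
    ⟨fun a ha b hb => h.commute a (hU ha) b (hV hb),
      (Subgroup.eq_bot_iff_forall _).2 fun a ha => h.eq_one_of_mem (hU ha.1) (hV ha.2), rfl⟩
  have htop : (⨆ i ∈ S, H i) ⊔ ⨆ i ∉ S, H i = ⊤ := by
    rw [← hH]
    refine le_antisymm (sup_le (iSup₂_le fun i _ => le_iSup _ _) (iSup₂_le fun i _ => le_iSup _ _))
      (iSup_le fun i => ?_)
    by_cases hi : i ∈ S
    · exact le_sup_of_le_left (le_iSup₂_of_le i hi le_rfl)
    · exact le_sup_of_le_right (le_iSup₂_of_le i hi le_rfl)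
  rw [htop] at hUV
  obtain ⟨s, hs, t, ht, rfl⟩ := hUV.exists_mul_of_mem (Subgroup.mem_top x)
  have : t = 1 := h.eq_one_of_mem ((X.mul_mem_cancel_left (hU hs)).1 hx) (hV ht)
  simpa [this] using hs

theorem preimageProd_eq_comap {G : Type u} [Group G] (N : Subgroup G) [N.Normal] {ι : Type*}
    (H : ι → Subgroup (G ⧸ N)) (S : Set ι) :
    preimageProd N H S = (⨆ i ∈ S, H i).comap (QuotientGroup.mk' N) := by
  have : ⨆ i ∈ S, H i = (⨆ i ∈ S, (H i).comap (QuotientGroup.mk' N)).map (QuotientGroup.mk' N) := by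
    simp only [Subgroup.map_iSup,
      Subgroup.map_comap_eq_self_of_surjective (QuotientGroup.mk'_surjective N)]
  rw [this, Subgroup.comap_map_eq, QuotientGroup.ker_mk', preimageProd, sup_comm]

theorem exists_perm_mem_iff_lt {n : ℕ} (S : Set (Fin n)) :
    ∃ (σ : Equiv.Perm (Fin n)) (m : ℕ), m ≤ n ∧ ∀ i, σ i ∈ S ↔ (i : ℕ) < m := by
  classical
  have hm : Fintype.card S ≤ n := by simpa using Fintype.card_subtype_le (· ∈ S)
  have e : {i : Fin n // (i : ℕ) < Fintype.card S} ≃ {i : Fin n // i ∈ S} := by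
    refine Fintype.equivOfCardEq ?_
    rw [Fintype.card_congr (Fin.castLEquiv hm).symm]
    simp
  refine ⟨e.extendSubtype, Fintype.card S, hm, fun i => ?_⟩
  by_cases hi : (i : ℕ) < Fintype.card S
  · exact iff_of_true (e.extendSubtype_mem i hi) hi
  · exact iff_of_false (e.extendSubtype_not_mem i hi) hi

end AbstractGroups

/-! ### Decompositions of the quotient by the hypercentre -/

section TopologicalGroups

open scoped commutatorElement

variable {G : Type u} [Group G]

/-- An element common to both images commutes with each of them, hence with the whole quotient,
whose centre is trivial. -/
theorem isDirectProduct_map_mk_hypercenter {A B : Subgroup G}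
    (hAB : ∀ a ∈ A, ∀ b ∈ B, Commute a b) (hsup : A ⊔ B = ⊤) :
    IsDirectProduct ⊤ (A.map (QuotientGroup.mk' (hypercenter G)))
      (B.map (QuotientGroup.mk' (hypercenter G))) := by
  have hsup' : A.map (QuotientGroup.mk' (hypercenter G)) ⊔
      B.map (QuotientGroup.mk' (hypercenter G)) = ⊤ := by
    rw [← Subgroup.map_sup, hsup,
      Subgroup.map_top_of_surjective _ (QuotientGroup.mk'_surjective _)]
  have hcomm : ∀ x ∈ A.map (QuotientGroup.mk' (hypercenter G)),
      ∀ y ∈ B.map (QuotientGroup.mk' (hypercenter G)), Commute x y := by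
    rintro _ ⟨a, ha, rfl⟩ _ ⟨b, hb, rfl⟩
    exact (hAB a ha b hb).map _
  refine ⟨hcomm, (Subgroup.eq_bot_iff_forall _).2 fun x hx => ?_, hsup'⟩
  have hle : (⊤ : Subgroup (G ⧸ hypercenter G)) ≤ Subgroup.centralizer {x} := by
    rw [← hsup']
    exact sup_le (fun a ha => Subgroup.mem_centralizer_singleton_iff.2 (hcomm a ha x hx.2))
      (fun b hb => Subgroup.mem_centralizer_singleton_iff.2 (hcomm x hx.1 b hb).symm)
  have hx' : x ∈ Subgroup.center (G ⧸ hypercenter G) := Subgroup.mem_center_iff.2 fun g =>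
    Subgroup.mem_centralizer_singleton_iff.1 (hle (Subgroup.mem_top g))
  rwa [center_quotient_hypercenter] at hx'

variable [TopologicalSpace G]

/-- Since `X` is the centralizer of `Y`, its preimage is cut out by the closed conditions that `⁅x,
b⁆` lie in the hypercentre, for `b` above `Y`. -/
theorem isClosed_of_isDirectProduct_quotient_hypercenter
    (hcomm : ∀ g : G, Continuous fun x : G => ⁅x, g⁆) (hN : IsClosed (hypercenter G : Set G))
    {X Y : Subgroup (G ⧸ hypercenter G)} (h : IsDirectProduct ⊤ X Y) :
    IsClosed (X : Set (G ⧸ hypercenter G)) := by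
  rw [← (QuotientGroup.isQuotientMap_mk (hypercenter G)).isClosed_preimage]
  have : (QuotientGroup.mk : G → G ⧸ hypercenter G) ⁻¹' X =
      ⋂ (b : G) (_ : (b : G ⧸ hypercenter G) ∈ Y), (fun x : G => ⁅x, b⁆) ⁻¹' hypercenter G := by
    ext x
    simp only [Set.mem_preimage, SetLike.mem_coe, Set.mem_iInter,
      h.mem_iff_of_center_eq_bot (center_quotient_hypercenter G)]
    refine ⟨fun H b hb => ?_, fun H y hy => ?_⟩
    · rw [← QuotientGroup.eq_one_iff, ← QuotientGroup.mk'_apply, map_commutatorElement]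
      exact commutatorElement_eq_one_iff_commute.2 (H _ hb)
    · obtain ⟨b, rfl⟩ := QuotientGroup.mk'_surjective _ y
      have := H b hy
      rw [← QuotientGroup.eq_one_iff, ← QuotientGroup.mk'_apply, map_commutatorElement] at this
      exact commutatorElement_eq_one_iff_commute.1 this
  rw [this]
  exact isClosed_iInter fun b => isClosed_iInter fun _ => hN.preimage (hcomm b)

/-- The decomposition theorem for a group generated by two commuting subgroups. -/
theorem decomposition_of_sup_eq_top
    (hcomm : ∀ g : G, Continuous fun x : G => ⁅x, g⁆) (hN : IsClosed (hypercenter G : Set G))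
    {A B : Subgroup G} (hAB : ∀ a ∈ A, ∀ b ∈ B, Commute a b) (hsup : A ⊔ B = ⊤) :
    (∀ (n : ℕ) (H : Fin n → Subgroup (G ⧸ hypercenter G)),
      (∀ i, IsIndecomposable (H i)) → IsInternalDirectProduct ⊤ H →
        ∃ (σ : Equiv.Perm (Fin n)) (m : ℕ), m ≤ n ∧
          A ≤ preimageProd (hypercenter G) (fun i => H (σ i)) {i | (i : ℕ) < m} ∧
          B ≤ preimageProd (hypercenter G) (fun i => H (σ i)) {i | m ≤ (i : ℕ)}) ∧
    (IsIndecomposable (⊤ : Subgroup (G ⧸ hypercenter G)) →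
      A ≤ hypercenter G ∨ B ≤ hypercenter G) := by
  have hXY := isDirectProduct_map_mk_hypercenter hAB hsup
  have hX := isClosed_of_isDirectProduct_quotient_hypercenter hcomm hN hXY
  have hY := isClosed_of_isDirectProduct_quotient_hypercenter hcomm hN hXY.symm
  refine ⟨fun n H hind hH => ?_, fun hind => ?_⟩
  · have hor : ∀ i, H i ≤ A.map (QuotientGroup.mk' (hypercenter G)) ∨
        H i ≤ B.map (QuotientGroup.mk' (hypercenter G)) := fun i =>
      IsDirectProduct.le_or_le_of_isIndecomposable (center_quotient_hypercenter G) hX hY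
        (hH.isDirectProduct_iSup_ne i) hXY (hind i)
    obtain ⟨σ, m, hm, hσ⟩ :=
      exists_perm_mem_iff_lt {i | H i ≤ A.map (QuotientGroup.mk' (hypercenter G))}
    have hHσ : ⨆ i, H (σ i) = ⊤ := by rw [σ.iSup_comp (g := H), hH.iSup_eq]
    refine ⟨σ, m, hm, ?_, ?_⟩
    · rw [preimageProd_eq_comap, ← Subgroup.map_le_iff_le_comap]
      refine hXY.le_iSup_of_forall_le_or_le hHσ (fun i hi => (hσ i).2 hi) fun i hi => ?_
      exact (hor _).resolve_left fun h => hi ((hσ i).1 h)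
    · rw [preimageProd_eq_comap, ← Subgroup.map_le_iff_le_comap]
      refine hXY.symm.le_iSup_of_forall_le_or_le hHσ (fun i hi => ?_) fun i hi => ?_
      · exact (hor _).resolve_left fun h => not_lt.2 hi ((hσ i).1 h)
      · exact (hσ i).2 (not_le.1 hi)
  · have := hind.eq_bot_or _ _ hX hY hXY
    simpa only [Subgroup.map_eq_bot_iff, QuotientGroup.ker_mk'] using this

end TopologicalGroups

/-! ### Dense constructible subgroups and closedness of the hypercentre -/

section IrreducibleChains

open scoped commutatorElement
open TopologicalSpace

variable {G : Type u} [Group G] [TopologicalSpace G]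

/-- The frontier of a constructible set is nowhere dense. -/
theorem interior_frontier_of_isConstructible {X : Type*} [TopologicalSpace X] {s : Set X}
    (hs : Topology.IsConstructible s) : interior (frontier s) = ∅ := by
  induction hs using Topology.IsConstructible.empty_union_induction with
  | open_retrocompact U hU _ =>
    rw [← frontier_compl]
    exact interior_frontier hU.isClosed_compl
  | union s _ t _ hs ht =>
    have h := interior_union_isClosed_of_interior_empty (isClosed_frontier (s := s)) ht
    rw [hs] at h
    refine Set.subset_eq_empty (interior_mono ?_) h
    refine (frontier_union_subset s t).trans ?_
    exact Set.union_subset_union Set.inter_subset_left Set.inter_subset_right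
  | compl s _ hs => rwa [frontier_compl]

/-- A dense constructible subgroup is the whole group. -/
theorem eq_top_of_dense_of_isConstructible [SeparatelyContinuousMul G] [ContinuousInv G]
    {M : Subgroup G} (hM : Dense (M : Set G)) (hc : Topology.IsConstructible (M : Set G)) :
    M = ⊤ := by
  have hd : Dense (interior (M : Set G)) := by
    have := interior_frontier_of_isConstructible hc
    rwa [frontier, hM.closure_eq, ← Set.compl_eq_univ_sdiff, interior_compl,
      Set.compl_empty_iff, ← dense_iff_closure_eq] at this
  refine (Subgroup.eq_top_iff' M).2 fun g => ?_
  -- The dense interior of `M` meets the nonempty open set of `x` with `g * x⁻¹` in that interior;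
  -- then `g = (g * x⁻¹) * x` lies in `M`.
  have ho : IsOpen ((fun x => g * x⁻¹) ⁻¹' interior (M : Set G)) := isOpen_interior.preimage
    ((continuous_const_mul g).comp continuous_inv)
  have hne : ((fun x => g * x⁻¹) ⁻¹' interior (M : Set G)).Nonempty := by
    obtain ⟨y, hy⟩ := hd.nonempty
    exact ⟨y⁻¹ * g, by simpa using hy⟩
  obtain ⟨x, hx, hx'⟩ := hd.inter_open_nonempty _ ho hne
  simpa using M.mul_mem (interior_subset hx) (interior_subset hx')

theorem isClosed_centralizer [T1Space G] (hcomm : ∀ g : G, Continuous fun x : G => ⁅x, g⁆)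
    (S : Set G) : IsClosed (Subgroup.centralizer S : Set G) := by
  have : (Subgroup.centralizer S : Set G) = ⋂ g ∈ S, (fun x : G => ⁅x, g⁆) ⁻¹' {1} := by
    ext x
    simp only [SetLike.mem_coe, Subgroup.mem_centralizer_iff, Set.mem_iInter, Set.mem_preimage,
      Set.mem_singleton_iff, commutatorElement_eq_one_iff_mul_comm]
    exact forall₂_congr fun _ _ => eq_comm
  rw [this]
  exact isClosed_biInter fun g _ => isClosed_singleton.preimage (hcomm g)

theorem isClosed_zeta_add_one (hcomm : ∀ g : G, Continuous fun x : G => ⁅x, g⁆) {α : Ordinal.{u}}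
    (h : IsClosed (zeta G α : Set G)) : IsClosed (zeta G (α + 1) : Set G) := by
  have : (zeta G (α + 1) : Set G) = ⋂ g : G, (fun x : G => ⁅x, g⁆) ⁻¹' zeta G α := by
    ext x
    simp [mem_zeta_add_one]
  rw [this]
  exact isClosed_iInter fun g => h.preimage (hcomm g)

/-- A continuous map from a connected space to a group, with values in finitely many cosets of a
closed subgroup, has values in only one of them. -/
theorem forall_mem_of_relIndex_ne_zero [SeparatelyContinuousMul G] {X : Type*} [TopologicalSpace X]
    [PreconnectedSpace X] {N M : Subgroup G} (hN : IsClosed (N : Set G)) (h : N.relIndex M ≠ 0)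
    {f : X → G} (hf : Continuous f) (hM : ∀ x, f x ∈ M) {x₀ : X} (hx₀ : f x₀ ∈ N) (x : X) :
    f x ∈ N := by
  have hindex : (N.subgroupOf M).FiniteIndex := ⟨h⟩
  have hfin : Finite (M ⧸ N.subgroupOf M) := Subgroup.finite_quotient_of_finiteIndex
  have hclopen : IsClopen (f ⁻¹' N) := by
    refine ⟨hN.preimage hf, ?_⟩
    -- The complement is the union of the preimages of the finitely many other cosets, each of them
    -- closed.
    have : (f ⁻¹' (N : Set G))ᶜ = ⋃ q ∈ {q : M ⧸ N.subgroupOf M | q ≠ (1 : M)},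
        (fun x => (q.out : G)⁻¹ * f x) ⁻¹' N := by
      ext y
      simp only [Set.mem_compl_iff, Set.mem_preimage, SetLike.mem_coe, Set.mem_iUnion,
        Set.mem_ofPred_eq, exists_prop]
      have key : ∀ q : M ⧸ N.subgroupOf M, (q.out : G)⁻¹ * f y ∈ N ↔ q = (⟨f y, hM y⟩ : M) := by
        intro q
        conv_rhs => rw [← QuotientGroup.out_eq' q]
        rw [QuotientGroup.eq, Subgroup.mem_subgroupOf]
        rfl
      simp only [key, exists_eq_right]
      rw [ne_comm, Ne, QuotientGroup.eq, Subgroup.mem_subgroupOf]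
      simp
    rw [← isClosed_compl_iff, this]
    exact (Set.toFinite _).isClosed_biUnion fun q _ =>
      hN.preimage ((continuous_const_mul _).comp hf)
  have := hclopen.eq_univ ⟨x₀, hx₀⟩
  exact (this ▸ Set.mem_univ x : x ∈ f ⁻¹' (N : Set G))

/-- For `x` in the term `α + 2`, the map `g ↦ ⁅x, g⁆` sends the connected `G` into finitely many
cosets of the term `α` and takes the value `1` at `1`. It thus stays in the term `α`. -/
theorem zeta_stable_of_relIndex_ne_zero [SeparatelyContinuousMul G] [ContinuousInv G]
    [PreconnectedSpace G] (hcomm : ∀ g : G, Continuous fun x : G => ⁅x, g⁆) {α : Ordinal.{u}}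
    (h : IsClosed (zeta G α : Set G)) (hα : (zeta G α).relIndex (zeta G (α + 1)) ≠ 0) :
    zeta G (α + 1 + 1) ≤ zeta G (α + 1) := by
  intro x hx
  rw [mem_zeta_add_one] at hx ⊢
  have hcont : Continuous fun g : G => ⁅x, g⁆ := by
    convert (hcomm x).inv using 2 with g
    exact (commutatorElement_inv g x).symm
  exact forall_mem_of_relIndex_ne_zero h hα hcont hx (x₀ := 1) (by simp)

/-- In a Noetherian group, an irreducible closed subset of a subgroup of infinite index in a closed
subgroup `M` can be enlarged to an irreducible closed subset of `M`. -/
theorem exists_lt_irreducibleCloseds [SeparatelyContinuousMul G] [NoetherianSpace G]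
    {N M : Subgroup G} (hNM : N ≤ M) (hM : IsClosed (M : Set G)) (h : N.relIndex M = 0)
    {C : IrreducibleCloseds G} (hC : (C : Set G) ⊆ N) :
    ∃ D : IrreducibleCloseds G, (D : Set G) ⊆ M ∧ C < D := by
  obtain ⟨S, hS, hScl, hSirr, hMS⟩ := NoetherianSpace.exists_finite_set_isClosed_irreducible hM
  have hcover : ∀ m ∈ M, ∃ t ∈ S, (fun x => m * x) '' C ⊆ t := fun m hm => by
    refine isIrreducible_iff_sUnion_isClosed.1
      (C.isIrreducible.image (fun x => m * x) (continuous_const_mul m).continuousOn) hS.toFinset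
      (fun t ht => hScl t (by simpa using ht)) ?_ |>.imp fun t ht => ⟨by simpa using ht.1, ht.2⟩
    rw [hS.coe_toFinset, ← hMS]
    rintro _ ⟨c, hc, rfl⟩
    exact M.mul_mem hm (hNM (hC hc))
  choose! t htS ht using hcover
  have hinf : Infinite (M ⧸ N.subgroupOf M) := Subgroup.index_eq_zero_iff_infinite.1 h
  have := hS.to_subtype
  -- Infinitely many cosets but finitely many pieces: translates of `C` by inequivalent `p`, `q` lie
  -- in one piece `t`. Then `D = p⁻¹ t` contains both `C` and `p⁻¹ q C`, and the latter does not
  -- meet `N`.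
  obtain ⟨p, q, hpq, he⟩ := Finite.exists_ne_map_eq_of_infinite
    fun q : M ⧸ N.subgroupOf M => (⟨t q.out, htS _ q.out.2⟩ : S)
  replace he : t p.out = t q.out := congrArg Subtype.val he
  have hpS := htS _ p.out.2
  refine ⟨⟨(Homeomorph.mulLeft (p.out : G)) ⁻¹' t p.out, ?_, ?_⟩, ?_, ?_⟩
  · rw [← Homeomorph.image_symm]
    exact (hSirr _ hpS).image _ (Homeomorph.continuous _).continuousOn
  · exact (hScl _ hpS).preimage (Homeomorph.continuous _)
  · intro x hx
    have : (p.out : G) * x ∈ M := hMS.ge (Set.mem_sUnion_of_mem hx hpS)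
    exact (M.mul_mem_cancel_left p.out.2).1 this
  · refine lt_of_le_not_ge (fun c hc => ht _ p.out.2 ⟨c, hc, rfl⟩) fun hle => hpq ?_
    obtain ⟨c, hc⟩ := C.isIrreducible.nonempty
    have h1 : (p.out : G)⁻¹ * (q.out * c) ∈ C := hle <| by
      change (p.out : G) * ((p.out : G)⁻¹ * (q.out * c)) ∈ t p.out
      rw [mul_inv_cancel_left, he]
      exact ht _ q.out.2 ⟨c, hc, rfl⟩
    have h2 := (N.mul_mem_cancel_right (hC hc)).1 ((mul_assoc (p.out : G)⁻¹ q.out c).symm ▸ hC h1)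
    rw [← QuotientGroup.out_eq' p, ← QuotientGroup.out_eq' q, QuotientGroup.eq]
    exact Subgroup.mem_subgroupOf.2 h2

/-- In a connected Noetherian group without infinite ascending chains of irreducible closed subsets,
the hypercentre is closed. -/
theorem isClosed_hypercenter [SeparatelyContinuousMul G] [ContinuousInv G] [T1Space G]
    [NoetherianSpace G] [PreconnectedSpace G] [WellFoundedGT (IrreducibleCloseds G)]
    (hcomm : ∀ g : G, Continuous fun x : G => ⁅x, g⁆) : IsClosed (hypercenter G : Set G) := by
  by_contra hnot
  have hstable : ∀ α : Ordinal.{u}, IsClosed (zeta G α : Set G) →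
      ¬ zeta G (α + 1) ≤ zeta G α := fun α hα h =>
    hnot (hypercenter_eq_zeta_of_stable h ▸ hα)
  -- Were the hypercentre not closed, every closed term would be followed, one step later, by a
  -- larger irreducible closed subset. Limit ordinals never enter: the climb starts from `{1}` in
  -- the term `0` and uses successors only.
  have key : ∀ (C : IrreducibleCloseds G) (α : Ordinal.{u}), IsClosed (zeta G α : Set G) →
      ¬ (C : Set G) ⊆ zeta G α := by
    intro C
    induction C using WellFoundedGT.induction with
    | ind C ih =>
      intro α hα hC
      have hα' := isClosed_zeta_add_one hcomm hα
      have h0 : (zeta G α).relIndex (zeta G (α + 1)) = 0 := by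
        by_contra h
        exact hstable _ hα' (zeta_stable_of_relIndex_ne_zero hcomm hα h)
      obtain ⟨D, hD, hlt⟩ := exists_lt_irreducibleCloseds (zeta_le_add_one G α) hα' h0 hC
      exact ih D hlt (α + 1) hα' hD
  refine key {1} 0 ?_ ?_
  · rw [zeta_zero]
    exact isClosed_singleton
  · rw [zeta_zero]
    intro x hx
    simpa using hx

end IrreducibleChains

/-! ### Ascending chains of irreducible closed subsets -/

section Schemes

open TopologicalSpace AlgebraicGeometry

/-- Enlarging an irreducible closed subset of `X` generizes its generic point and lowers the
dimension of the local ring there, which is finite because that ring is Noetherian. An inducing map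
transfers this to `Y`. -/
theorem wellFoundedGT_irreducibleCloseds_of_isInducing {X : Scheme.{u}} [IsLocallyNoetherian X]
    {Y : Type*} [TopologicalSpace Y] {f : Y → X} (hf : Topology.IsInducing f) :
    WellFoundedGT (IrreducibleCloseds Y) := by
  let _ : PartialOrder X := specializationOrder X
  have hX : WellFoundedGT X := by
    have hfin : ∀ x : X, Order.coheight x < ⊤ := fun x => by
      have h := ringKrullDim_lt_top (R := X.presheaf.stalk x)
      rw [ringKrullDim_stalk_eq_coheight] at h
      exact WithBot.coe_lt_coe.1 h
    exact ⟨Subrelation.wf (fun {x y} (hxy : y < x) => Order.coheight_strictAnti hxy (hfin x))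
      (InvImage.wf Order.coheight wellFounded_lt)⟩
  have hIX : WellFoundedGT (IrreducibleCloseds X) :=
    (irreducibleSetEquivPoints (α := X)).strictMono.wellFoundedGT
  exact (IrreducibleCloseds.map_strictMono_of_isInducing hf).wellFoundedGT

end Schemes

/-! ### The Zariski topology on the group of `K`-points -/

section AlgebraicGroups

open CategoryTheory AlgebraicGeometry MonoidalCategory CartesianMonoidalCategory
open scoped MonObj commutatorElement

variable {K : Type u} [Field K]

namespace Points

section Schemes

variable {X Y : Over (Spec (.of K))}

/-- The map on `K`-points induced by a morphism. -/
noncomputable def map (f : X ⟶ Y) (x : Points X) : Points Y :=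
  (show Over.mk (𝟙 (Spec (.of K))) ⟶ X from x) ≫ f

theorem map_id (x : Points X) : map (𝟙 X) x = x :=
  Category.comp_id _

theorem isInducing_toPoint : Topology.IsInducing (toPoint : Points X → X.left) :=
  ⟨rfl⟩

theorem continuous_map (f : X ⟶ Y) : Continuous (map f) :=
  isInducing_toPoint.continuous_iff.2 (f.left.continuous.comp isInducing_toPoint.continuous)

/-- The constant morphism with value a `K`-point. -/
noncomputable def const (g : Points X) : Y ⟶ X :=
  toUnit Y ≫ g

theorem map_const (g : Points X) (x : Points Y) : map (const g : Y ⟶ X) x = g := by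
  have h (y : Over.mk (𝟙 (Spec (.of K))) ⟶ Y) (z : Over.mk (𝟙 (Spec (.of K))) ⟶ X) :
      y ≫ toUnit Y ≫ z = z := by
    rw [← Category.assoc, toUnit_unique (y ≫ toUnit Y) (𝟙 _)]
    exact Category.id_comp _
  exact h x g

theorem exists_map_fst_eq_map_snd_eq (x : Points X) (y : Points Y) :
    ∃ z : Points (X ⊗ Y), map (fst X Y) z = x ∧ map (snd X Y) z = y :=
  ⟨(lift x y : Over.mk (𝟙 (Spec (.of K))) ⟶ X ⊗ Y), lift_fst _ _, lift_snd _ _⟩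

theorem isNoetherian_left [LocallyOfFiniteType X.hom] [QuasiCompact X.hom] :
    IsNoetherian X.left where
  toIsLocallyNoetherian := LocallyOfFiniteType.isLocallyNoetherian X.hom
  toCompactSpace := by
    have : CompactSpace ((Functor.fromPUnit (Spec (CommRingCat.of K))).obj X.right) :=
      inferInstanceAs (CompactSpace (Spec (CommRingCat.of K)))
    exact QuasiCompact.compactSpace_of_compactSpace X.hom

theorem locallyOfFiniteType_tensorObj_hom [LocallyOfFiniteType X.hom]
    [LocallyOfFiniteType Y.hom] : LocallyOfFiniteType (X ⊗ Y).hom := by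
  dsimp; infer_instance

theorem quasiCompact_tensorObj_hom [QuasiCompact X.hom] [QuasiCompact Y.hom] :
    QuasiCompact (X ⊗ Y).hom := by
  dsimp; infer_instance

theorem noetherianSpace [LocallyOfFiniteType X.hom] [QuasiCompact X.hom] :
    TopologicalSpace.NoetherianSpace (Points X) :=
  have := isNoetherian_left (X := X)
  isInducing_toPoint.noetherianSpace

variable [IsAlgClosed K] [LocallyOfFiniteType X.hom]

theorem toPoint_injective : Function.Injective (toPoint : Points X → X.left) := by
  intro x y h
  refine Over.OverMorphism.ext ?_
  exact ext_of_apply_closedPoint_eq X.hom (Over.w x) (Over.w y) h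

theorem range_toPoint : Set.range (toPoint : Points X → X.left) = closedPoints X.left := by
  ext p
  constructor
  · rintro ⟨x, rfl⟩
    exact (pointEquivClosedPoint X.hom ⟨_, Over.w x⟩).2
  · intro hp
    exact ⟨Over.homMk (pointOfClosedPoint X.hom p hp) (pointOfClosedPoint_comp X.hom p hp),
      pointOfClosedPoint_apply X.hom p hp _⟩

instance : T1Space (Points X) where
  t1 x := by
    have h : IsClosed {x.toPoint} :=
      (range_toPoint (X := X)).le (Set.mem_range_self x)
    have := h.preimage (isInducing_toPoint (X := X)).continuous
    rwa [← Set.image_singleton, Set.preimage_image_eq _ toPoint_injective] at this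

/-- A nonempty locally closed subset contains a `K`-point. -/
theorem exists_toPoint_mem {Z : Set X.left} (hZ : IsLocallyClosed Z) (hne : Z.Nonempty) :
    ∃ x : Points X, x.toPoint ∈ Z := by
  have : JacobsonSpace X.left := LocallyOfFiniteType.jacobsonSpace X.hom
  obtain ⟨p, hp, hp'⟩ := nonempty_inter_closedPoints hne hZ
  obtain ⟨x, rfl⟩ := (range_toPoint (X := X)).ge hp'
  exact ⟨x, hp⟩

end Schemes

section Groups

variable {G : Over (Spec (.of K))} [GrpObj G]

theorem map_mul (f h : G ⟶ G) (x : Points G) : map (f * h) x = map f x * map h x :=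
  MonObj.comp_mul _ _ _

theorem map_inv (f : G ⟶ G) (x : Points G) : map f⁻¹ x = (map f x)⁻¹ :=
  GrpObj.comp_inv _ _

instance : SeparatelyContinuousMul (Points G) where
  continuous_const_mul {g} := by
    convert continuous_map (const g * 𝟙 G) using 2 with x
    simp only [map_mul, map_const, map_id]
  continuous_mul_const {g} := by
    convert continuous_map (𝟙 G * const g) using 2 with x
    simp only [map_mul, map_const, map_id]

instance : ContinuousInv (Points G) where
  continuous_inv := by
    convert continuous_map (𝟙 G)⁻¹ using 2 with x
    simp only [map_inv, map_id]

/-- Multiplication need not be jointly continuous for the Zariski topology; with `g` fixed, however,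
the commutator is induced by a morphism of schemes. -/
theorem continuous_commutator (g : Points G) : Continuous fun x : Points G => ⁅x, g⁆ := by
  convert continuous_map (𝟙 G * const g * (𝟙 G)⁻¹ * (const g)⁻¹) using 2 with x
  simp only [map_mul, map_inv, map_const, map_id, commutatorElement_def]

theorem map_fst_mul_map_snd (z : Points (G ⊗ G)) :
    map (fst G G) z * map (snd G G) z = map μ[G] z := by
  have h (y : Over.mk (𝟙 (Spec (.of K))) ⟶ G ⊗ G) :
      (y ≫ fst G G) * (y ≫ snd G G) = y ≫ μ[G] := by
    rw [← MonObj.comp_mul, Hom.mul_def, lift_fst_snd, Category.id_comp]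
  exact h z

open scoped Pointwise in
/-- The product of two closed subsets of an algebraic group is constructible. -/
theorem isConstructible_mul [IsAlgClosed K] [LocallyOfFiniteType G.hom] [QuasiCompact G.hom]
    {S T : Set (Points G)} (hS : IsClosed S) (hT : IsClosed T) : Topology.IsConstructible (S * T) := by
  have := isNoetherian_left (X := G)
  have := locallyOfFiniteType_tensorObj_hom (X := G) (Y := G)
  have := quasiCompact_tensorObj_hom (X := G) (Y := G)
  have := isNoetherian_left (X := G ⊗ G)
  have hμ : LocallyOfFiniteType μ[G].left := by
    have : LocallyOfFiniteType (μ[G].left ≫ G.hom) := by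
      rw [Over.w]; infer_instance
    exact locallyOfFiniteType_of_comp _ G.hom
  obtain ⟨S', hS', rfl⟩ := isInducing_toPoint.isClosed_iff.1 hS
  obtain ⟨T', hT', rfl⟩ := isInducing_toPoint.isClosed_iff.1 hT
  set Z : Set (G ⊗ G).left := (fst G G).left ⁻¹' S' ∩ (snd G G).left ⁻¹' T'
  have hZcl : IsClosed Z :=
    (hS'.preimage (fst G G).left.continuous).inter (hT'.preimage (snd G G).left.continuous)
  have hZc : Topology.IsConstructible Z := by
    rw [← Topology.isConstructible_compl]
    exact (TopologicalSpace.NoetherianSpace.isCompact _).isConstructible hZcl.isOpen_compl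
  have himage : Topology.IsConstructible (μ[G].left '' Z) :=
    Scheme.Hom.isConstructible_image μ[G].left hZc
  have heq : toPoint ⁻¹' S' * toPoint ⁻¹' T' =
      (toPoint : Points G → G.left) ⁻¹' (μ[G].left '' Z) := by
    ext x
    constructor
    · rintro ⟨s, hs, t, ht, rfl⟩
      obtain ⟨z, rfl, rfl⟩ := exists_map_fst_eq_map_snd_eq s t
      exact ⟨z.toPoint, ⟨hs, ht⟩, congrArg toPoint (map_fst_mul_map_snd z).symm⟩
    · rintro ⟨p, hp, hpx⟩
      have hx : IsClosed {x.toPoint} := (range_toPoint (X := G)).le (Set.mem_range_self x)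
      -- The part of `Z` above the closed point `x` is closed and nonempty, so it contains a
      -- `K`-point, whose coordinates are the required factors.
      obtain ⟨z, hz, hzx⟩ := exists_toPoint_mem
        (hZcl.inter (hx.preimage μ[G].left.continuous)).isLocallyClosed ⟨p, hp, hpx⟩
      refine ⟨map (fst G G) z, hz.1, map (snd G G) z, hz.2, ?_⟩
      exact (map_fst_mul_map_snd z).trans (toPoint_injective hzx)
  rw [heq]
  have := noetherianSpace (X := G)
  exact himage.preimage isInducing_toPoint.continuous fun U hU _ =>
    (TopologicalSpace.NoetherianSpace.isCompact _).isRetrocompact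
      (hU.preimage isInducing_toPoint.continuous)

end Groups

end Points

end AlgebraicGroups

end DirectDecomposition

open CategoryTheory AlgebraicGeometry DirectDecomposition in
/-- An algebraic group over the algebraically closed field `K` is a group variety `G` (reduced,
separated, of finite type), identified with its group of `K`-points with the Zariski topology. The
quotient by the closed normal subgroup `hypercenter` carries the quotient group structure and the
quotient topology, which is its Zariski topology. -/
theorem proposition5 {K : Type u} [Field K] [IsAlgClosed K]
    (G : Over (Spec (.of K))) [GrpObj G] [IsReduced G.left] [IsSeparated G.hom]
    [LocallyOfFiniteType G.hom] [QuasiCompact G.hom]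
    (hG : ConnectedSpace (Points G) ∨ IsClosed (hypercenter (Points G) : Set (Points G)))
    (Γ A B : Subgroup (Points G)) (hΓ : Dense (Γ : Set (Points G)))
    (hAB : IsDirectProduct Γ A B) :
    (∀ (n : ℕ) (H : Fin n → Subgroup (Points G ⧸ hypercenter (Points G))),
      (∀ i, IsIndecomposable (H i)) → IsInternalDirectProduct ⊤ H →
        preimageProd (hypercenter (Points G)) H Set.univ = ⊤ ∧
        (∀ i, (H i).comap (QuotientGroup.mk' (hypercenter (Points G))) ⊓
          preimageProd (hypercenter (Points G)) H {j | j ≠ i} = hypercenter (Points G)) ∧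
        ∃ (σ : Equiv.Perm (Fin n)) (m : ℕ), m ≤ n ∧
          A ≤ preimageProd (hypercenter (Points G)) (fun i => H (σ i)) {i | (i : ℕ) < m} ∧
          B ≤ preimageProd (hypercenter (Points G)) (fun i => H (σ i)) {i | m ≤ (i : ℕ)}) ∧
    (IsIndecomposable (⊤ : Subgroup (Points G ⧸ hypercenter (Points G))) →
      A ≤ hypercenter (Points G) ∨ B ≤ hypercenter (Points G)) := by
  have := Points.noetherianSpace (X := G)
  have hcomm := Points.continuous_commutator (G := G)
  have hN : IsClosed (hypercenter (Points G) : Set (Points G)) := by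
    refine hG.elim (fun _ => ?_) id
    have := Points.isNoetherian_left (X := G)
    have := wellFoundedGT_irreducibleCloseds_of_isInducing (Points.isInducing_toPoint (X := G))
    exact isClosed_hypercenter hcomm
  -- Centralizers rather than closures: they are automatically closed subgroups containing `A` and
  -- `B`, and they commute with each other.
  have hA := isClosed_centralizer hcomm (B : Set (Points G))
  have hB := isClosed_centralizer hcomm
    (Subgroup.centralizer (B : Set (Points G)) : Set (Points G))
  have hAle : A ≤ Subgroup.centralizer (B : Set (Points G)) := fun a ha =>
    Subgroup.mem_centralizer_iff.2 fun b hb => (hAB.commute a ha b hb).symm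
  have hBle : B ≤
      Subgroup.centralizer (Subgroup.centralizer (B : Set (Points G)) : Set (Points G)) :=
    fun b hb => Subgroup.mem_centralizer_iff.2 fun a ha =>
      (Subgroup.mem_centralizer_iff.1 ha b hb).symm
  have hcommAB : ∀ a ∈ Subgroup.centralizer (B : Set (Points G)),
      ∀ b ∈ Subgroup.centralizer (Subgroup.centralizer (B : Set (Points G)) : Set (Points G)),
        Commute a b := fun a ha b hb => Subgroup.mem_centralizer_iff.1 hb a ha
  have hsup := eq_top_of_dense_of_isConstructible
    (M := Subgroup.centralizer (B : Set (Points G)) ⊔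
      Subgroup.centralizer (Subgroup.centralizer (B : Set (Points G)) : Set (Points G)))
    (hΓ.mono (hAB.sup_eq ▸ sup_le_sup hAle hBle)) <| by
      rw [Subgroup.coe_mul_of_right_le_normalizer_left _ _
        (Subgroup.centralizer_le_normalizer _)]
      exact Points.isConstructible_mul hA hB
  obtain ⟨h1, h2⟩ := decomposition_of_sup_eq_top hcomm hN hcommAB hsup
  refine ⟨fun n H hind hH => ⟨?_, fun i => ?_, ?_⟩, fun hind => ?_⟩
  · simp only [preimageProd_eq_comap, Set.mem_univ, iSup_pos, hH.iSup_eq, Subgroup.comap_top]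
  · rw [preimageProd_eq_comap, ← Subgroup.comap_inf]
    have := (hH.isDirectProduct_iSup_ne i).inf_eq
    rw [show ⨆ j ∈ {j | j ≠ i}, H j = ⨆ j ≠ i, H j from rfl, this, MonoidHom.comap_bot,
      QuotientGroup.ker_mk']
  · obtain ⟨σ, m, hm, hAm, hBm⟩ := h1 n H hind hH
    exact ⟨σ, m, hm, hAle.trans hAm, hBle.trans hBm⟩
  · exact (h2 hind).imp hAle.trans hBle.trans
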